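/- For integers $n,d\ge 1$ and $\varepsilon\in(0,1)$ put $L=1+\log\frac{nd}{\varepsilon}$. For a nonempty finite set $T\subset\mathbb{R}^d$ let $\mathrm{MEB}(T)$ be the smallest Euclidean ball containing $T$, and let $(1+\varepsilon)\cdot\mathrm{MEB}(T)$ be the ball with the same center and $(1+\varepsilon)$ times the radius. For constants $C>0$ and $c\in\mathbb{N}$, the problem $\varepsilon$-MEB-Coreset is the following. Given query access to the entries of an $n\times d$ real matrix $A$ with rows $A_1,\dots,A_n$, together with the norms $\|A_1\|,\dots,\|A_n\|$ and the promise that $\|A_i\|\le R$ for all $i$, output a nonempty set $S$ of at most $C\varepsilon^{-1}L^{c}$ rows of $A$ such that $A_i\in(1+\varepsilon)\cdot\mathrm{MEB}(S)$ for all $i=1,\dots,n$. A randomized algorithm draws random coins from an arbitrary probability space; given the coins and the norms of the rows, it reads entries of $A$ adaptively and then outputs a set of row indices. **Theorem.** For all $C>0$ and $c\in\mathbb{N}$ there are constants $K>0$, $k\in\mathbb{N}$, $c_0>0$ and $m\in\mathbb{N}$, depending only on $C$ and $c$, such that the following holds for all $n,d\ge1$, $\varepsilon\in(0,1)$ and $R>0$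 with $$n\varepsilon^{-1}\ge d\qquad\text{and}\qquad d\ge K\varepsilon^{-2}L^{k}.$$ If a randomized algorithm solves $\varepsilon$-MEB-Coreset (with constants $C,c$ and norm bound $R$) with probability at least $4/5$ on every $n\times d$ matrix with all $\|A_i\|\le R$, then there is such a matrix $A$ on which, for some choice of its random coins (indeed with positive probability), it reads at least $c_0\,n\varepsilon^{-2}/L^{m}$ distinct entries of $A$. That is, it must read $\tilde\Omega(n\varepsilon^{-2})$ entries. -/

import Mathlib

open MeasureTheory

/-- A deterministic adaptive algorithm that has query access to the entries of an `n × d` real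
matrix and outputs a set of row indices: a decision tree that may branch on the exact value of
the entry that it has just read. -/
inductive QueryTree (n d : ℕ) : Type
  | output (S : Finset (Fin n)) : QueryTree n d
  | read (i : Fin n) (j : Fin d) (next : ℝ → QueryTree n d) : QueryTree n d

namespace QueryTree

variable {n d : ℕ}

/-- The set of row indices that is output on the matrix with rows `A 0, …, A (n - 1)`. -/
def result (A : Fin n → EuclideanSpace ℝ (Fin d)) : QueryTree n d → Finset (Fin n)
  | output S => S
  | read i j next => result A (next (A i j))

/-- The positions of the matrix that are read in the run on `A`
(a position that is read repeatedly counts once). -/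
def positionsRead (A : Fin n → EuclideanSpace ℝ (Fin d)) :
    QueryTree n d → Finset (Fin n × Fin d)
  | output _ => ∅
  | read i j next => insert (i, j) (positionsRead A (next (A i j)))

end QueryTree

/-- A randomized algorithm with random coins `ω : Ω`. It is given the Euclidean norms of all the
rows for free; these norms and the coins determine a deterministic adaptive algorithm. -/
structure RandomizedAlgorithm (Ω : Type*) [MeasurableSpace Ω] (n d : ℕ) where
  tree : Ω → (Fin n → ℝ) → QueryTree n d
  measurableSet_result : ∀ (A : Fin n → EuclideanSpace ℝ (Fin d)) (S : Finset (Fin n)),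
    MeasurableSet {ω | (tree ω fun i => ‖A i‖).result A = S}

namespace RandomizedAlgorithm

variable {Ω : Type*} [MeasurableSpace Ω] {n d : ℕ}

/-- The output on input `A` with coins `ω`. -/
noncomputable def result (alg : RandomizedAlgorithm Ω n d) (A : Fin n → EuclideanSpace ℝ (Fin d)) (ω : Ω) :
    Finset (Fin n) :=
  (alg.tree ω fun i => ‖A i‖).result A

/-- The number of entries of `A` that are read with coins `ω`. -/
noncomputable def entriesRead (alg : RandomizedAlgorithm Ω n d) (A : Fin n → EuclideanSpace ℝ (Fin d))
    (ω : Ω) : ℕ :=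
  ((alg.tree ω fun i => ‖A i‖).positionsRead A).card

end RandomizedAlgorithm

/-- The closed ball with center `x` and radius `r` is the minimum enclosing ball of `T`. -/
def IsMEB {d : ℕ} (T : Set (EuclideanSpace ℝ (Fin d))) (x : EuclideanSpace ℝ (Fin d)) (r : ℝ) :
    Prop :=
  T ⊆ Metric.closedBall x r ∧ ∀ y s, T ⊆ Metric.closedBall y s → r ≤ s

/-- `S` is a nonempty set of at most `k` rows of `A` such that every row of `A` lies in the ball
`(1 + ε) • MEB(S)`, which has the center of `MEB(S)` and `1 + ε` times its radius. -/
def IsMEBCoreset {n d : ℕ} (ε k : ℝ) (A : Fin n → EuclideanSpace ℝ (Fin d))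
    (S : Finset (Fin n)) : Prop :=
  S.Nonempty ∧ (S.card : ℝ) ≤ k ∧
    ∃ x r, IsMEB (A '' S) x r ∧ ∀ i, A i ∈ Metric.closedBall x ((1 + ε) * r)

/-- For every matrix whose rows have norm at most `R`, the algorithm outputs with probability at
least `4/5` an `ε`-MEB-coreset with at most `k` rows. -/
def RandomizedAlgorithm.SolvesMEBCoreset {Ω : Type*} [MeasurableSpace Ω] {n d : ℕ}
    (alg : RandomizedAlgorithm Ω n d) (P : Measure Ω) (ε k R : ℝ) : Prop :=
  ∀ A : Fin n → EuclideanSpace ℝ (Fin d), (∀ i, ‖A i‖ ≤ R) →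
    4 / 5 ≤ P {ω | IsMEBCoreset ε k A (alg.result A ω)}

/-- The base of the polylogarithmic factors; it is at least `1` for `n, d ≥ 1` and `ε ≤ 1`. -/
noncomputable def logFactor (n d : ℕ) (ε : ℝ) : ℝ :=
  1 + Real.log (n * d / ε)

/-! By averaging over the coins, it suffices to defeat one decision tree on a random matrix. For
small ε, and up to scaling by R/2, one row is -2u with u = (1, …, 1)/√d. The other rows have
independent entries ±1/√d whose signs have mean -μ, where μ = 32ε, except for a planted row p with
mean +μ. Since d is at least of order ε⁻² log n, with probability at least 9/10 all the relevant
inner products are within 2ε of their means (`bitExpect.paritySum_tail_le`). If a coreset S missed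
p, the row -2u would drag the center x of MEB(S) to ⟪u, x⟫ ≤ -1/2. Row p leans towards u, so it
would be farther from x than a boundary row of S by more than the factor 1 + ε permits. Hence every
coreset contains p (`IsMEBCoreset.mem_of_nearly_orthogonal`).

Finding p means detecting a bias: each entry read in row p contributes only O(μ²) to the divergence
between the planted law and the reference law in which every bias is -μ. Under the reference law, a
run with at most q reads distributes them over all the rows, and an output of size at most k
contains at most k candidates. Summing `QueryTree.bitExpect_change_of_measure` over p therefore
bounds the total success by 2(k + 4μ²q). The hypotheses on n and d give k ≤ n/20, so q must be of
order nε⁻².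

For ε > 1/512 a bound linear in n suffices; there the planted row is the negative of all the others.
The count of reads loses no logarithm: logarithms enter only through the hypothesis on d. -/

open scoped RealInnerProductSpace

/-! ### Product distributions on bits -/

/-- The expectation of `f` when the bits `σ x` are independent with distributions `p x`. -/
noncomputable def bitExpect {ι : Type*} [Fintype ι] [DecidableEq ι] (p : ι → Bool → ℝ)
    (f : (ι → Bool) → ℝ) : ℝ :=
  ∑ σ : ι → Bool, (∏ x, p x (σ x)) * f σ

namespace bitExpect

variable {ι : Type*} [Fintype ι] [DecidableEq ι] {p : ι → Bool → ℝ}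

theorem sum_prod (p : ι → Bool → ℝ) : ∑ σ : ι → Bool, ∏ x, p x (σ x) = ∏ x, ∑ b, p x b := by
  rw [Finset.prod_univ_sum, Fintype.piFinset_univ]

theorem const (hp : ∀ x, ∑ b, p x b = 1) (a : ℝ) : bitExpect p (fun _ => a) = a := by
  rw [bitExpect, ← Finset.sum_mul, sum_prod, Finset.prod_congr rfl fun x _ => hp x]
  simp

theorem mono (hp : ∀ x b, 0 ≤ p x b) {f g : (ι → Bool) → ℝ} (h : ∀ σ, f σ ≤ g σ) :
    bitExpect p f ≤ bitExpect p g :=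
  Finset.sum_le_sum fun σ _ =>
    mul_le_mul_of_nonneg_left (h σ) (Finset.prod_nonneg fun x _ => hp x _)

theorem nonneg (hp : ∀ x b, 0 ≤ p x b) {f : (ι → Bool) → ℝ} (h : ∀ σ, 0 ≤ f σ) :
    0 ≤ bitExpect p f :=
  Finset.sum_nonneg fun σ _ => mul_nonneg (Finset.prod_nonneg fun x _ => hp x _) (h σ)

theorem add (f g : (ι → Bool) → ℝ) :
    bitExpect p (fun σ => f σ + g σ) = bitExpect p f + bitExpect p g := by
  simp only [bitExpect, mul_add, Finset.sum_add_distrib]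

theorem const_mul (a : ℝ) (f : (ι → Bool) → ℝ) :
    bitExpect p (fun σ => a * f σ) = a * bitExpect p f := by
  simp only [bitExpect, Finset.mul_sum]
  exact Finset.sum_congr rfl fun σ _ => by ring

theorem sum {κ : Type*} (s : Finset κ) (f : κ → (ι → Bool) → ℝ) :
    bitExpect p (fun σ => ∑ k ∈ s, f k σ) = ∑ k ∈ s, bitExpect p (f k) := by
  simp only [bitExpect, Finset.mul_sum]
  exact Finset.sum_comm

/-- The distribution of a bit that is known to be `b`. -/
def pointBit (b : Bool) : Bool → ℝ := fun b' => if b' = b then 1 else 0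

theorem prod_update (x : ι) (b : Bool) (σ : ι → Bool) :
    ∏ y, Function.update p x (pointBit b) y (σ y) =
      pointBit b (σ x) * ∏ y ∈ Finset.univ.erase x, p y (σ y) := by
  rw [← Finset.mul_prod_erase _ _ (Finset.mem_univ x), Function.update_self]
  congr 1
  refine Finset.prod_congr rfl fun y hy => ?_
  rw [Function.update_of_ne (Finset.ne_of_mem_erase hy)]

/-- Conditioning on a single bit. -/
theorem eq_sum_update (p : ι → Bool → ℝ) (x : ι) (f : (ι → Bool) → ℝ) :
    bitExpect p f = ∑ b, p x b * bitExpect (Function.update p x (pointBit b)) f := by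
  simp only [bitExpect, prod_update, Finset.mul_sum]
  rw [Finset.sum_comm]
  refine Finset.sum_congr rfl fun σ _ => ?_
  rw [← Finset.mul_prod_erase _ _ (Finset.mem_univ x), Fintype.sum_bool]
  cases h : σ x <;> simp [pointBit] <;> ring

theorem update_congr {x : ι} {b : Bool} {f g : (ι → Bool) → ℝ} (h : ∀ σ, σ x = b → f σ = g σ) :
    bitExpect (Function.update p x (pointBit b)) f =
      bitExpect (Function.update p x (pointBit b)) g := by
  refine Finset.sum_congr rfl fun σ _ => ?_
  by_cases hb : σ x = b
  · rw [h σ hb]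
  · simp [prod_update, pointBit, hb]

end bitExpect

/-! ### Change of measure along a decision tree -/

/-- The matrix whose entry at each position is determined by the bit at that position. -/
noncomputable def bitMatrix {n d : ℕ} (v : Fin n → Fin d → Bool → ℝ) (σ : Fin n × Fin d → Bool) :
    Fin n → EuclideanSpace ℝ (Fin d) :=
  fun i => WithLp.toLp 2 fun j => v i j (σ (i, j))

open bitExpect in
/-- A change of measure: the divergence between the runs of a query algorithm under two product
distributions is at most `κ` for each read of a position at which the distributions differ. -/
theorem QueryTree.bitExpect_change_of_measure {n d : ℕ} (v : Fin n → Fin d → Bool → ℝ)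
    (hit : Finset (Fin n) → Prop) [DecidablePred hit] (κ : ℝ) (T : QueryTree n d) :
    ∀ (p₀ p₁ : Fin n × Fin d → Bool → ℝ) (U : Finset (Fin n × Fin d)) (a : ℝ),
      (∀ x b, 0 ≤ p₀ x b) → (∀ x, ∑ b, p₀ x b = 1) → (∀ x, ∑ b, p₁ x b = 1) →
      (∀ x, x ∉ U → p₀ x = p₁ x) → (∀ x ∈ U, ∀ b, 0 < p₀ x b ∧ 0 < p₁ x b) →
      (∀ x ∈ U, -κ ≤ ∑ b, p₀ x b * Real.log (p₁ x b / p₀ x b)) →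
      a + (1 - bitExpect p₀ fun σ => if hit (T.result (bitMatrix v σ)) then 1 else 0)
          - κ * bitExpect p₀ (fun σ => ((T.positionsRead (bitMatrix v σ) ∩ U).card : ℝ)) ≤
        Real.exp a * (1 - (1 - Real.exp (-1)) *
          bitExpect p₁ fun σ => if hit (T.result (bitMatrix v σ)) then 1 else 0) := by
  -- This is the Donsker–Varadhan inequality: for the log-likelihood ratio ℓ of the run and the
  -- indicator f of `hit`, ℓ + 1 - f ≤ exp (ℓ - f), and the mean of exp (ℓ - f) under `p₀` is the
  -- mean of exp (-f) under `p₁`. The number `a` is the part of ℓ accumulated so far.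
  induction T with
  | output S =>
    intro p₀ p₁ U a _ h0 h1 _ _ _
    change a + (1 - bitExpect p₀ fun _ => if hit S then 1 else 0)
        - κ * bitExpect p₀ (fun _ => (((∅ : Finset (Fin n × Fin d)) ∩ U).card : ℝ)) ≤
      Real.exp a * (1 - (1 - Real.exp (-1)) * bitExpect p₁ fun _ => if hit S then 1 else 0)
    rw [const h0, const h0, const h1, Finset.empty_inter, Finset.card_empty, Nat.cast_zero,
      mul_zero, sub_zero]
    -- Both cases are y + 1 ≤ exp y, at y = a - 1 on a hit and at y = a otherwise.
    split_ifs
    · have := Real.add_one_le_exp (a - 1)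
      rw [sub_eq_add_neg, Real.exp_add] at this
      linarith
    · have := Real.add_one_le_exp a
      linarith
  | read i j next ih =>
    intro p₀ p₁ U a hnn h0 h1 heq hpos hκ
    set x : Fin n × Fin d := (i, j) with hx
    -- Outside `U` the weights may vanish (bits already read are frozen), but there the laws agree
    -- and ℓ = 0 works.
    obtain ⟨ℓ, hℓ, hsum⟩ : ∃ ℓ : Bool → ℝ, (∀ b, p₁ x b = p₀ x b * Real.exp (ℓ b)) ∧
        -(κ * if x ∈ U then 1 else 0) ≤ ∑ b, p₀ x b * ℓ b := by
      by_cases hxU : x ∈ U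
      · refine ⟨fun b => Real.log (p₁ x b / p₀ x b), fun b => ?_, ?_⟩
        · obtain ⟨hb0, hb1⟩ := hpos x hxU b
          rw [Real.exp_log (div_pos hb1 hb0)]
          field_simp
        · simpa [hxU] using hκ x hxU
      · exact ⟨0, fun b => by simp [heq x hxU], by simp [hxU]⟩
    -- After the answer `b` the bit is frozen in both laws and `x` leaves `U`, so that reading it
    -- again costs nothing.
    have key : ∀ b, a + ℓ b + (1 - bitExpect (Function.update p₀ x (pointBit b))
          fun σ => if hit (((next (v i j b))).result (bitMatrix v σ)) then 1 else 0)
        - κ * bitExpect (Function.update p₀ x (pointBit b))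
          (fun σ => (((next (v i j b)).positionsRead (bitMatrix v σ) ∩ U.erase x).card : ℝ)) ≤
        Real.exp (a + ℓ b) * (1 - (1 - Real.exp (-1)) *
          bitExpect (Function.update p₁ x (pointBit b))
            fun σ => if hit ((next (v i j b)).result (bitMatrix v σ)) then 1 else 0) := by
      intro b
      have hpt : ∀ y, y ≠ x → Function.update p₀ x (pointBit b) y = p₀ y := fun y hy =>
        Function.update_of_ne hy _ _
      have hpt1 : ∀ y, y ≠ x → Function.update p₁ x (pointBit b) y = p₁ y := fun y hy =>
        Function.update_of_ne hy _ _
      have hone : ∑ b', pointBit b b' = 1 := by simp [pointBit]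
      apply ih
      · intro y b'
        by_cases hy : y = x
        · subst hy
          simp only [Function.update_self, pointBit]
          split_ifs <;> norm_num
        · rw [hpt y hy]; exact hnn y b'
      · intro y
        by_cases hy : y = x
        · subst hy; simp only [Function.update_self, hone]
        · rw [hpt y hy]; exact h0 y
      · intro y
        by_cases hy : y = x
        · subst hy; simp only [Function.update_self, hone]
        · rw [hpt1 y hy]; exact h1 y
      · intro y hyU
        by_cases hy : y = x
        · subst hy; simp only [Function.update_self]
        · rw [hpt y hy, hpt1 y hy]
          exact heq y fun h => hyU (Finset.mem_erase.2 ⟨hy, h⟩)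
      · intro y hyU b'
        obtain ⟨hy, hyU⟩ := Finset.mem_erase.1 hyU
        rw [hpt y hy, hpt1 y hy]
        exact hpos y hyU b'
      · intro y hyU
        obtain ⟨hy, hyU⟩ := Finset.mem_erase.1 hyU
        rw [hpt y hy, hpt1 y hy]
        exact hκ y hyU
    have hres : ∀ p : Fin n × Fin d → Bool → ℝ,
        (bitExpect p fun σ => if hit ((read i j next).result (bitMatrix v σ)) then (1 : ℝ) else 0) =
          ∑ b, p x b * bitExpect (Function.update p x (pointBit b))
            fun σ => if hit ((next (v i j b)).result (bitMatrix v σ)) then 1 else 0 := by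
      intro p
      rw [eq_sum_update p x]
      refine Finset.sum_congr rfl fun b _ => congrArg _ (update_congr fun σ hσ => ?_)
      simp only [result, bitMatrix, ← hx, hσ]
    have hread : bitExpect p₀
          (fun σ => (((read i j next).positionsRead (bitMatrix v σ) ∩ U).card : ℝ)) =
        ∑ b, p₀ x b * (bitExpect (Function.update p₀ x (pointBit b)) (fun σ =>
          (((next (v i j b)).positionsRead (bitMatrix v σ) ∩ U.erase x).card : ℝ)) +
            if x ∈ U then 1 else 0) := by
      rw [eq_sum_update p₀ x]
      refine Finset.sum_congr rfl fun b _ => congrArg _ ?_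
      have hone : ∀ y, ∑ b', Function.update p₀ x (pointBit b) y b' = 1 := by
        intro y
        by_cases hy : y = x
        · subst hy; simp [Function.update_self, pointBit]
        · rw [Function.update_of_ne hy]; exact h0 y
      rw [← const hone (if x ∈ U then 1 else 0), ← bitExpect.add]
      refine update_congr fun σ hσ => ?_
      have : (read i j next).positionsRead (bitMatrix v σ) =
          insert x ((next (v i j b)).positionsRead (bitMatrix v σ)) := by
        simp only [positionsRead, bitMatrix, ← hx, hσ]
      rw [this]
      by_cases hxU : x ∈ U
      · have hc : insert x ((next (v i j b)).positionsRead (bitMatrix v σ)) ∩ U =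
            insert x ((next (v i j b)).positionsRead (bitMatrix v σ) ∩ U.erase x) := by
          ext y
          by_cases hy : y = x <;> simp [hy, hxU]
        rw [if_pos hxU, hc, Finset.card_insert_of_notMem (by simp), Nat.cast_add, Nat.cast_one]
      · rw [if_neg hxU, Finset.insert_inter_of_notMem hxU, Finset.erase_eq_of_notMem hxU, add_zero]
    rw [hres p₀, hres p₁, hread]
    have hp0 := h0 x
    have hp1 := h1 x
    rw [Fintype.sum_bool] at hp0 hp1
    have kb := fun b => (mul_le_mul_of_nonneg_left (key b) (hnn x b)).trans_eq
      (show _ = Real.exp a * (p₁ x b * (1 - (1 - Real.exp (-1)) *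
          bitExpect (Function.update p₁ x (pointBit b))
            fun σ => if hit ((next (v i j b)).result (bitMatrix v σ)) then 1 else 0)) by
        rw [hℓ, Real.exp_add]; ring)
    have kt := kb true
    have kf := kb false
    simp only [Fintype.sum_bool] at hsum ⊢
    have e1 : p₀ x true * a + p₀ x false * a = a := by rw [← add_mul, hp0, one_mul]
    have e2 : Real.exp a * p₁ x true + Real.exp a * p₁ x false = Real.exp a := by
      rw [← mul_add, hp1, mul_one]
    have e3 : p₀ x true * (κ * if x ∈ U then 1 else 0) + p₀ x false * (κ * if x ∈ U then 1 else 0)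
        = κ * if x ∈ U then 1 else 0 := by rw [← add_mul, hp0, one_mul]
    linarith

/-! ### Geometry of minimum enclosing balls -/

namespace IsMEB

variable {d : ℕ} {T : Set (EuclideanSpace ℝ (Fin d))} {x : EuclideanSpace ℝ (Fin d)} {r : ℝ}

/-- The center of the minimum enclosing ball of a finite set is in the convex hull of those points
of the set that are on the boundary of the ball. -/
theorem center_mem_convexHull (h : IsMEB T x r) (hT : T.Finite) :
    x ∈ convexHull ℝ {z ∈ T | ‖z - x‖ = r} := by
  by_contra hx
  obtain ⟨f, u, hfx, hfz⟩ := geometric_hahn_banach_point_closed (convex_convexHull ℝ _)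
    ((hT.subset (Set.sep_subset T _)).isClosed_convexHull ℝ) hx
  set w : EuclideanSpace ℝ (Fin d) := (InnerProductSpace.toDual ℝ (EuclideanSpace ℝ (Fin d))).symm f with hw
  have hf : ∀ z, f z = ⟪w, z⟫ := fun z => by simp [hw]
  -- Moving the center slightly along the separating direction `w` brings the boundary points
  -- strictly closer, and the interior points stay inside, so a smaller ball would suffice.
  have hev : ∀ z ∈ T, ∀ᶠ t in nhdsWithin (0 : ℝ) (Set.Ioi 0), ‖z - (x + t • w)‖ < r := by
    intro z hz
    have hzr : ‖z - x‖ ≤ r := by simpa [dist_eq_norm] using h.1 hz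
    rcases hzr.lt_or_eq with hlt | heq
    · have hc : ContinuousAt (fun t : ℝ => ‖z - (x + t • w)‖) 0 := by fun_prop
      exact (hc.eventually_lt continuousAt_const (by simpa using hlt)).filter_mono
        nhdsWithin_le_nhds
    · have hpos : 0 < ⟪w, z - x⟫ := by
        have := hfz z (subset_convexHull ℝ _ ⟨hz, heq⟩)
        rw [inner_sub_right, ← hf, ← hf]
        linarith
      have hc : ContinuousAt (fun t : ℝ => t * ‖w‖ ^ 2) 0 := by fun_prop
      have hlt := (hc.eventually_lt (continuousAt_const (y := 2 * ⟪w, z - x⟫))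
        (by simpa using hpos)).filter_mono (nhdsWithin_le_nhds (s := Set.Ioi (0 : ℝ)))
      filter_upwards [hlt, self_mem_nhdsWithin] with t ht ht0
      rw [Set.mem_Ioi] at ht0
      have hsq : ‖z - (x + t • w)‖ ^ 2 = ‖z - x‖ ^ 2 - t * (2 * ⟪w, z - x⟫ - t * ‖w‖ ^ 2) := by
        rw [← sub_sub, norm_sub_sq_real, inner_smul_right, norm_smul, real_inner_comm, mul_pow,
          Real.norm_eq_abs, sq_abs]
        ring
      refine lt_of_pow_lt_pow_left₀ 2 (heq ▸ norm_nonneg _) ?_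
      rw [hsq, heq]
      linarith [mul_pos ht0 (sub_pos.2 ht)]
  obtain ⟨t, ht⟩ := ((hT.eventually_all).2 hev).exists
  rcases T.eq_empty_or_nonempty with rfl | hne
  -- The empty set has no minimum enclosing ball here, since radii may be negative.
  · have := h.2 0 (r - 1) (Set.empty_subset _)
    linarith
  · obtain ⟨z, hz, hmax⟩ := hT.exists_maximalFor (fun z => ‖z - (x + t • w)‖) T hne
    have := h.2 (x + t • w) ‖z - (x + t • w)‖ fun y hy => by
      rw [Metric.mem_closedBall, dist_eq_norm]
      exact (le_total _ _).elim id fun hle => hmax hy hle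
    linarith [ht z hz]

/-- A linear inequality that holds at the boundary points of `T` holds at the center. -/
theorem inner_le (h : IsMEB T x r) (hT : T.Finite) {w : EuclideanSpace ℝ (Fin d)} {b : ℝ}
    (hb : ∀ z ∈ T, ⟪w, z⟫ ≤ b) : ⟪w, x⟫ ≤ b := by
  have hsub : convexHull ℝ {z ∈ T | ‖z - x‖ = r} ⊆ {z | ⟪w, z⟫ ≤ b} :=
    convexHull_min (fun z hz => hb z hz.1)
      (convex_halfSpace_le (innerSL ℝ w).toLinearMap.isLinear b)
  exact hsub (h.center_mem_convexHull hT)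

theorem radius_le (h : IsMEB T x r) {s : ℝ} (hs : ∀ z ∈ T, ‖z‖ ≤ s) : r ≤ s :=
  h.2 0 s fun z hz => by simpa using hs z hz

theorem norm_sub_le (h : IsMEB T x r) {z : EuclideanSpace ℝ (Fin d)} (hz : z ∈ T) :
    ‖z - x‖ ≤ r := by
  simpa [dist_eq_norm] using h.1 hz

theorem smul (h : IsMEB T x r) {ρ : ℝ} (hρ : 0 < ρ) :
    IsMEB ((fun z => ρ • z) '' T) (ρ • x) (ρ * r) := by
  refine ⟨?_, fun y s hs => ?_⟩
  · rintro _ ⟨z, hz, rfl⟩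
    rw [Metric.mem_closedBall, dist_eq_norm, ← smul_sub, norm_smul, Real.norm_of_nonneg hρ.le]
    exact mul_le_mul_of_nonneg_left (h.norm_sub_le hz) hρ.le
  · have := h.2 (ρ⁻¹ • y) (ρ⁻¹ * s) fun z hz => by
      have hz := hs ⟨z, hz, rfl⟩
      rw [Metric.mem_closedBall, dist_eq_norm] at hz ⊢
      rw [show z - ρ⁻¹ • y = ρ⁻¹ • (ρ • z - y) by rw [smul_sub, inv_smul_smul₀ hρ.ne'],
        norm_smul, norm_inv, Real.norm_of_nonneg hρ.le]
      exact mul_le_mul_of_nonneg_left hz (inv_nonneg.2 hρ.le)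
    rwa [← div_eq_inv_mul, le_div_iff₀ hρ, mul_comm] at this

end IsMEB

theorem IsMEBCoreset.smul {n d : ℕ} {ε k : ℝ} {A : Fin n → EuclideanSpace ℝ (Fin d)}
    {S : Finset (Fin n)} (h : IsMEBCoreset ε k A S) {ρ : ℝ} (hρ : 0 < ρ) :
    IsMEBCoreset ε k (fun i => ρ • A i) S := by
  obtain ⟨hS, hk, x, r, hx, hA⟩ := h
  refine ⟨hS, hk, ρ • x, ρ * r, ?_, fun i => ?_⟩
  · have := hx.smul hρ
    rwa [Set.image_image] at this
  · have := hA i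
    rw [Metric.mem_closedBall, dist_eq_norm] at this ⊢
    rw [← smul_sub, norm_smul, Real.norm_of_nonneg hρ.le, mul_left_comm]
    exact mul_le_mul_of_nonneg_left this hρ.le

/-- Nearly orthogonal unit vectors, all but one of which (`A p`) form a slightly obtuse angle with
`u`, together with the vector `A o = -2u`: every `ε`-coreset contains `p`. -/
theorem IsMEBCoreset.mem_of_nearly_orthogonal {n d : ℕ} {ε k μ t : ℝ}
    {A : Fin n → EuclideanSpace ℝ (Fin d)} {S : Finset (Fin n)} (h : IsMEBCoreset ε k A S)
    {o p : Fin n} {u : EuclideanSpace ℝ (Fin d)} (hε : 0 < ε) (hμ : μ = 32 * ε) (ht : t = μ / 16)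
    (hμ1 : μ ≤ 1 / 16) (hop : o ≠ p) (hu : ‖u‖ = 1) (ho : A o = (-2 : ℝ) • u)
    (hA : ∀ i, i ≠ o → ‖A i‖ = 1)
    (hui : ∀ i, i ≠ o → i ≠ p → |⟪u, A i⟫ + μ| ≤ t) (hup : |⟪u, A p⟫ - μ| ≤ t)
    (hij : ∀ i j, i ≠ o → j ≠ o → i ≠ p → j ≠ p → i ≠ j → |⟪A i, A j⟫ - μ ^ 2| ≤ t)
    (hip : ∀ i, i ≠ o → i ≠ p → |⟪A p, A i⟫ + μ ^ 2| ≤ t) : p ∈ S := by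
  by_contra hpS
  obtain ⟨hS, -, x, r, hx, hball⟩ := h
  have hfin : (A '' S).Finite := S.finite_toSet.image A
  have hμ0 : 0 < μ := by linarith
  have hball' : ∀ i, ‖A i - x‖ ≤ (1 + ε) * r := fun i => by
    simpa [dist_eq_norm] using hball i
  have hr0 : 0 ≤ r := by
    obtain ⟨i, hi⟩ := hS
    exact (norm_nonneg _).trans (hx.norm_sub_le (Set.mem_image_of_mem A hi))
  have hr2 : r ≤ 2 := hx.radius_le <| by
    rintro _ ⟨i, -, rfl⟩
    by_cases hi : i = o
    · rw [hi, ho, norm_smul, hu]; norm_num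
    · rw [hA i hi]; norm_num
  -- (1 + ε)² - 1 ≤ 3ε and r² ≤ 4.
  have hsq : ∀ i, ‖A i - x‖ ^ 2 ≤ r ^ 2 + 12 * ε := fun i => by
    refine (pow_le_pow_left₀ (norm_nonneg _) (hball' i) 2).trans ?_
    nlinarith [mul_nonneg hε.le (sub_nonneg.2 (pow_le_pow_left₀ hr0 hr2 2)),
      mul_nonneg (mul_nonneg hε.le hε.le) (sub_nonneg.2 (pow_le_pow_left₀ hr0 hr2 2))]
  have huu : ⟪u, u⟫ = (1 : ℝ) := by rw [real_inner_self_eq_norm_sq, hu, one_pow]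
  -- Otherwise the ball is the single point `A o`, of norm 2, and cannot contain `A p`, of norm 1.
  have hbd : ∃ j ∈ S, j ≠ o ∧ ‖A j - x‖ = r := by
    by_contra! hcon
    have hsub : {z ∈ A '' S | ‖z - x‖ = r} ⊆ {A o} := by
      rintro _ ⟨⟨i, hi, rfl⟩, hir⟩
      by_cases hio : i = o
      · rw [hio]; rfl
      · exact absurd hir (hcon i hi hio)
    have hxo : x = A o := by
      have := convexHull_mono hsub (hx.center_mem_convexHull hfin)
      rwa [convexHull_singleton] at this
    have hne : {z ∈ A '' S | ‖z - x‖ = r}.Nonempty :=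
      convexHull_nonempty_iff.1 ⟨x, hx.center_mem_convexHull hfin⟩
    obtain ⟨z, hz⟩ := hne
    have hr : r = 0 := by rw [← hz.2, hsub hz, hxo, sub_self, norm_zero]
    have hp := hball' p
    rw [hr, mul_zero, hxo, norm_le_zero_iff, sub_eq_zero] at hp
    have h1 := hA p hop.symm
    rw [hp, ho, norm_smul, hu] at h1
    norm_num at h1
  obtain ⟨j, hjS, hjo, hjr⟩ := hbd
  have hjp : j ≠ p := fun h => hpS (h ▸ hjS)
  have hjj : ⟪A j, A j⟫ = (1 : ℝ) := by rw [real_inner_self_eq_norm_sq, hA j hjo, one_pow]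
  have hAj : ∀ i ∈ S, i ≠ o → -t ≤ ⟪A j, A i⟫ := by
    intro i hi hio
    by_cases hij' : i = j
    · rw [hij', hjj]; linarith
    · have := abs_le.1 (hij j i hjo hio hjp (fun h => hpS (h ▸ hi)) (Ne.symm hij'))
      linarith [sq_nonneg μ]
  have huj := abs_le.1 (hui j hjo hjp)
  rw [real_inner_comm] at huj
  rw [abs_le, real_inner_comm] at hup
  have hjx : -⟪A j, x⟫ ≤ t := by
    rw [← inner_neg_left]
    refine hx.inner_le hfin ?_
    rintro _ ⟨i, hi, rfl⟩
    rw [inner_neg_left]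
    by_cases hio : i = o
    · rw [hio, ho, inner_smul_right]; linarith
    · linarith [hAj i hi hio]
  -- Subtracting (μ/2)u costs only O(μ²) at the unit rows. At `A o` it adds μ, which the term of
  -- about -2μ from the bias absorbs. It is this correction that converts ⟪u, x⟫ ≤ -1/2 into a gain
  -- of order μ, here for `A p` and below for `-A j`.
  have hpx : ⟪A p - (μ / 2) • u, x⟫ ≤ t + μ ^ 2 := by
    refine hx.inner_le hfin ?_
    rintro _ ⟨i, hi, rfl⟩
    rw [inner_sub_left, inner_smul_left]
    simp only [conj_trivial]
    by_cases hio : i = o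
    · rw [hio, ho, inner_smul_right, inner_smul_right, huu]
      linarith [sq_nonneg μ]
    · have hip' : i ≠ p := fun h => hpS (h ▸ hi)
      have h1 := abs_le.1 (hip i hio hip')
      have h2 := abs_le.1 (hui i hio hip')
      nlinarith
  have hjx' : ⟪-A j - (μ / 2) • u, x⟫ ≤ t + μ ^ 2 := by
    refine hx.inner_le hfin ?_
    rintro _ ⟨i, hi, rfl⟩
    rw [inner_sub_left, inner_smul_left, inner_neg_left]
    simp only [conj_trivial]
    by_cases hio : i = o
    · rw [hio, ho, inner_smul_right, inner_smul_right, huu]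
      linarith [sq_nonneg μ]
    · have hip' : i ≠ p := fun h => hpS (h ▸ hi)
      have h1 := hAj i hi hio
      have h2 := abs_le.1 (hui i hio hip')
      nlinarith
  rw [inner_sub_left, inner_smul_left] at hpx hjx'
  rw [inner_neg_left] at hjx'
  simp only [conj_trivial] at hpx hjx'
  have hoj := hsq o
  have hpj := hsq p
  rw [← hjr, norm_sub_sq_real, norm_sub_sq_real, hA j hjo] at hoj hpj
  rw [ho, norm_smul, hu, inner_smul_left] at hoj
  rw [hA p hop.symm] at hpj
  simp only [conj_trivial] at hoj
  norm_num at hoj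
  -- Comparing the distances of `A o` and `A j` gives 4⟪u, x⟫ ≤ -3 + 2t + 12ε. Comparing `A p` and
  -- `A j` gives ⟪A p - A j, x⟫ ≥ -6ε = -3μ/16, while `hpx` and `hjx'` add up to at most -μ/2 + 2t +
  -- 2μ² ≤ -μ/4.
  have hux : ⟪u, x⟫ ≤ -1 / 2 := by linarith
  nlinarith

/-! ### Biased signs and concentration -/

def bitSign (b : Bool) : ℝ := if b then 1 else -1

/-- The distribution of a bit with `bitSign` of mean `m`. -/
noncomputable def coin (m : ℝ) (b : Bool) : ℝ := (1 + m * bitSign b) / 2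

theorem bitSign_mul_self (b : Bool) : bitSign b * bitSign b = 1 := by
  cases b <;> simp [bitSign]

theorem abs_bitSign (b : Bool) : |bitSign b| = 1 := by
  cases b <;> simp [bitSign]

theorem sum_coin (m : ℝ) : ∑ b, coin m b = 1 := by
  simp only [coin, bitSign, Fintype.sum_bool, if_true, Bool.false_eq_true, if_false]
  ring

theorem coin_pos {m : ℝ} (hm : |m| < 1) (b : Bool) : 0 < coin m b := by
  have := abs_lt.1 hm
  cases b <;> simp only [coin, bitSign, if_true, Bool.false_eq_true, if_false] <;> linarith

/-- A bound for the divergence of two coins with opposite bias. -/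
theorem neg_le_sum_coin_log {μ : ℝ} (h0 : 0 < μ) (h1 : μ ≤ 1 / 2) :
    -(4 * μ ^ 2) ≤ ∑ b, coin (-μ) b * Real.log (coin μ b / coin (-μ) b) := by
  simp only [coin, bitSign, Fintype.sum_bool, if_true, Bool.false_eq_true, if_false]
  have e1 : (1 + μ * 1) / 2 / ((1 + -μ * 1) / 2) = (1 + μ) / (1 - μ) := by
    rw [div_div_div_cancel_right₀ two_ne_zero, mul_one, mul_one, ← sub_eq_add_neg]
  have e2 : (1 + μ * -1) / 2 / ((1 + -μ * -1) / 2) = ((1 + μ) / (1 - μ))⁻¹ := by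
    rw [div_div_div_cancel_right₀ two_ne_zero, inv_div, mul_neg_one, neg_mul_neg, mul_one,
      ← sub_eq_add_neg]
  rw [e1, e2, Real.log_inv]
  -- The sum is -μ log((1 + μ)/(1 - μ)), so a linear bound for the logarithm is enough.
  have hlog : Real.log ((1 + μ) / (1 - μ)) ≤ 4 * μ := by
    refine (Real.log_le_sub_one_of_pos (div_pos (by linarith) (by linarith))).trans ?_
    rw [sub_le_iff_le_add, div_le_iff₀ (by linarith)]
    nlinarith
  nlinarith

/-- The distribution of the bits of a matrix with independent entries and row biases `m`. -/
noncomputable def rowCoin {n : ℕ} (d : ℕ) (m : Fin n → ℝ) : Fin n × Fin d → Bool → ℝ :=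
  fun x => coin (m x.1)

/-- The sum over all columns of the product of the signs in the rows of `Q`. -/
def paritySum {n d : ℕ} (Q : Finset (Fin n)) (σ : Fin n × Fin d → Bool) : ℝ :=
  ∑ c, ∏ r ∈ Q, bitSign (σ (r, c))

namespace bitExpect

variable {n d : ℕ}

theorem rowCoin_prod_columns (m : Fin n → ℝ) (g : (Fin n → Bool) → ℝ) :
    bitExpect (rowCoin d m) (fun σ => ∏ c, g fun r => σ (r, c)) =
      bitExpect (fun r => coin (m r)) g ^ d := by
  rw [bitExpect, bitExpect, Fintype.sum_pow]
  refine Fintype.sum_equiv ⟨fun σ c r => σ (r, c), fun τ x => τ x.2 x.1, fun _ => rfl,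
    fun _ => rfl⟩ _ _ fun σ => ?_
  rw [Finset.prod_mul_distrib, Fintype.prod_prod_type_right]
  rfl

theorem coin_parity (m : Fin n → ℝ) (Q : Finset (Fin n)) :
    bitExpect (fun r => coin (m r)) (fun τ => ∏ r ∈ Q, bitSign (τ r)) = ∏ r ∈ Q, m r := by
  have h : ∀ τ : Fin n → Bool, (∏ r, coin (m r) (τ r)) * ∏ r ∈ Q, bitSign (τ r) =
      ∏ r, (fun r b => coin (m r) b * if r ∈ Q then bitSign b else 1) r (τ r) := by
    intro τ
    simp only
    rw [Finset.prod_mul_distrib, Finset.prod_ite_mem, Finset.univ_inter]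
  simp only [bitExpect, h]
  rw [sum_prod fun r b => coin (m r) b * if r ∈ Q then bitSign b else 1, ← Finset.univ_inter Q, ← Finset.prod_ite_mem]
  refine Finset.prod_congr rfl fun r _ => ?_
  rw [Finset.univ_inter]
  by_cases hr : r ∈ Q
  · simp only [coin, bitSign, Fintype.sum_bool, if_true, Bool.false_eq_true, if_false, hr]
    ring
  · simpa [hr] using sum_coin (m r)

variable {m : Fin n → ℝ}

/-- The columns are independent, and in each of them exp z ≤ 1 + z + z² for |z| ≤ 1, where z² = l²
because a product of signs is ±1. -/
theorem exp_paritySum_le (hm : ∀ i, |m i| < 1) (Q : Finset (Fin n)) {l : ℝ} (hl : |l| ≤ 1) :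
    bitExpect (rowCoin d m) (fun σ => Real.exp (l * paritySum Q σ)) ≤
      Real.exp (d * (l * ∏ r ∈ Q, m r + l ^ 2)) := by
  have hnn : ∀ i b, 0 ≤ coin (m i) b := fun i b => (coin_pos (hm i) b).le
  have h : ∀ σ : Fin n × Fin d → Bool, Real.exp (l * paritySum Q σ) =
      ∏ c, (fun τ : Fin n → Bool => Real.exp (l * ∏ r ∈ Q, bitSign (τ r))) fun r => σ (r, c) := by
    intro σ
    rw [paritySum, Finset.mul_sum, Real.exp_sum]
  simp only [h]
  rw [rowCoin_prod_columns m fun τ : Fin n → Bool => Real.exp (l * ∏ r ∈ Q, bitSign (τ r)),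
    Real.exp_nat_mul]
  refine pow_le_pow_left₀ (Finset.sum_nonneg fun τ _ =>
    mul_nonneg (Finset.prod_nonneg fun i _ => hnn i _) (Real.exp_pos _).le) ?_ d
  calc bitExpect (fun r => coin (m r)) (fun τ => Real.exp (l * ∏ r ∈ Q, bitSign (τ r)))
      ≤ bitExpect (fun r => coin (m r)) (fun τ => (1 + l ^ 2) + l * ∏ r ∈ Q, bitSign (τ r)) := by
        refine mono hnn fun τ => ?_
        have hz : |∏ r ∈ Q, bitSign (τ r)| = 1 := by
          rw [Finset.abs_prod]
          exact Finset.prod_eq_one fun r _ => abs_bitSign _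
        have hlz : |l * ∏ r ∈ Q, bitSign (τ r)| = |l| := by rw [abs_mul, hz, mul_one]
        have := (abs_le.1 (Real.abs_exp_sub_one_sub_id_le (hlz.le.trans hl))).2
        rw [← sq_abs (l * _), hlz, sq_abs] at this
        linarith
    _ = 1 + l ^ 2 + l * ∏ r ∈ Q, m r := by
        rw [add, const fun i => sum_coin _, const_mul, coin_parity]
    _ ≤ _ := by
        have := Real.add_one_le_exp (l * ∏ r ∈ Q, m r + l ^ 2)
        linarith

/-- Chernoff bound with l = ±t/2, which minimizes l² - |l|t; t ≤ 2 ensures |l| ≤ 1. -/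
theorem paritySum_tail_le (hm : ∀ i, |m i| < 1) (Q : Finset (Fin n)) {t : ℝ} (h0 : 0 ≤ t)
    (h1 : t ≤ 2) :
    bitExpect (rowCoin d m) (fun σ =>
        if t * d < |paritySum Q σ - d * ∏ r ∈ Q, m r| then 1 else 0) ≤
      2 * Real.exp (-(d * t ^ 2 / 4)) := by
  set M := ∏ r ∈ Q, m r with hM
  have hside : ∀ l : ℝ, l ^ 2 = t ^ 2 / 4 →
      Real.exp (-(l * d * M) - t ^ 2 * d / 2) *
        bitExpect (rowCoin d m) (fun σ => Real.exp (l * paritySum Q σ)) ≤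
        Real.exp (-(d * t ^ 2 / 4)) := by
    intro l hl
    have hl1 : |l| ≤ 1 := by
      rw [← sq_le_one_iff_abs_le_one, hl]
      nlinarith
    refine (mul_le_mul_of_nonneg_left (exp_paritySum_le hm Q hl1) (Real.exp_pos _).le).trans_eq ?_
    rw [← Real.exp_add, ← hM, hl]
    congr 1
    ring
  have h : ∀ z : ℝ, (if t * d < |z - d * M| then (1 : ℝ) else 0) ≤
      Real.exp (-(t / 2 * d * M) - t ^ 2 * d / 2) * Real.exp (t / 2 * z) +
      Real.exp (-(-(t / 2) * d * M) - t ^ 2 * d / 2) * Real.exp (-(t / 2) * z) := by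
    intro z
    rw [← Real.exp_add, ← Real.exp_add]
    split_ifs with hlt
    · rcases lt_abs.1 hlt with hlt | hlt
      · refine le_add_of_le_of_nonneg (Real.one_le_exp ?_) (Real.exp_pos _).le
        linarith [mul_nonneg h0 (sub_nonneg.2 hlt.le)]
      · refine le_add_of_nonneg_of_le (Real.exp_pos _).le (Real.one_le_exp ?_)
        linarith [mul_nonneg h0 (sub_nonneg.2 hlt.le)]
    · exact add_nonneg (Real.exp_pos _).le (Real.exp_pos _).le
  refine le_trans (mono (p := rowCoin d m) (fun x b => (coin_pos (hm x.1) b).le)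
    fun σ => h (paritySum Q σ)) ?_
  rw [add, const_mul _ fun σ => Real.exp (t / 2 * paritySum Q σ),
    const_mul _ fun σ => Real.exp (-(t / 2) * paritySum Q σ), two_mul]
  exact add_le_add (hside _ (by ring)) (hside _ (by ring))

end bitExpect

/-! ### Derandomization -/

namespace RandomizedAlgorithm

variable {Ω : Type*} [MeasurableSpace Ω] {n d : ℕ}

theorem measurableSet_isMEBCoreset (alg : RandomizedAlgorithm Ω n d) (ε k : ℝ)
    (A : Fin n → EuclideanSpace ℝ (Fin d)) :
    MeasurableSet {ω | IsMEBCoreset ε k A (alg.result A ω)} := by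
  have : {ω | IsMEBCoreset ε k A (alg.result A ω)} =
      ⋃ S ∈ {S | IsMEBCoreset ε k A S}, {ω | (alg.tree ω fun i => ‖A i‖).result A = S} := by
    ext ω
    simp [RandomizedAlgorithm.result]
  rw [this]
  exact MeasurableSet.biUnion (Set.to_countable _) fun S _ => alg.measurableSet_result A S

open Classical in
/-- Derandomization: on finitely many weighted matrices, some outcome of the coins is as good as
the average. -/
theorem exists_coins {I : Type*} [Fintype I] {alg : RandomizedAlgorithm Ω n d} {P : Measure Ω}
    [IsProbabilityMeasure P] {ε k R q : ℝ} (hsolve : alg.SolvesMEBCoreset P ε k R)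
    (hread : ∀ A : Fin n → EuclideanSpace ℝ (Fin d), (∀ i, ‖A i‖ ≤ R) →
      P {ω | q ≤ alg.entriesRead A ω} = 0)
    (w : I → ℝ) (hw : ∀ a, 0 ≤ w a) (A : I → Fin n → EuclideanSpace ℝ (Fin d))
    (hA : ∀ a i, ‖A a i‖ ≤ R) :
    ∃ ω, (∀ a, (alg.entriesRead (A a) ω : ℝ) < q) ∧ 4 / 5 * ∑ a, w a ≤
      ∑ a, w a * if IsMEBCoreset ε k (A a) (alg.result (A a) ω) then 1 else 0 := by
  set G : I → Set Ω := fun a => {ω | IsMEBCoreset ε k (A a) (alg.result (A a) ω)} with hG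
  have hGm : ∀ a, MeasurableSet (G a) := fun a => alg.measurableSet_isMEBCoreset ε k (A a)
  have hint : ∀ a ∈ Finset.univ, Integrable (fun ω => w a * (G a).indicator (1 : Ω → ℝ) ω) P :=
    fun a _ => ((integrable_const (1 : ℝ)).indicator (hGm a)).const_mul _
  have hmean : 4 / 5 * ∑ a, w a ≤ ∫ ω, ∑ a, w a * (G a).indicator (1 : Ω → ℝ) ω ∂P := by
    rw [integral_finsetSum _ hint, Finset.mul_sum]
    refine Finset.sum_le_sum fun a _ => ?_
    rw [integral_const_mul, integral_indicator_one (hGm a), mul_comm]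
    refine mul_le_mul_of_nonneg_left ?_ (hw a)
    have h := hsolve (A a) (hA a)
    have := ENNReal.toReal_mono (measure_ne_top P _) h
    rw [ENNReal.toReal_div] at this
    exact this
  have hae : ∀ᵐ ω ∂P, ∀ a, (alg.entriesRead (A a) ω : ℝ) < q := by
    rw [ae_all_iff]
    intro a
    rw [ae_iff]
    simpa only [not_lt] using hread (A a) (hA a)
  -- A function is at least its mean with positive probability, so this event meets the almost sure
  -- bound on the reads.
  have hpos := measure_integral_le_pos (integrable_finsetSum _ hint)
  obtain ⟨ω, hω, hωq⟩ := (frequently_ae_iff.2 hpos.ne').and_eventually hae |>.exists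
  refine ⟨ω, hωq, hmean.trans (hω.trans_eq (Finset.sum_congr rfl fun a _ => ?_))⟩
  simp [Set.indicator_apply, hG]

end RandomizedAlgorithm

/-- A row that is not read does not affect the output. -/
theorem QueryTree.result_congr {n d : ℕ} {A B : Fin n → EuclideanSpace ℝ (Fin d)}
    (T : QueryTree n d) (h : ∀ x ∈ T.positionsRead A, A x.1 x.2 = B x.1 x.2) :
    T.result B = T.result A := by
  induction T with
  | output S => rfl
  | read i j next ih =>
    simp only [result, positionsRead, Finset.mem_insert, forall_eq_or_imp] at h ⊢
    rw [← h.1]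
    exact ih _ h.2

/-! ### The hard matrices -/

/-- The hard matrices: row `o` is constant, the other rows consist of signs. -/
noncomputable def hardEntry {n : ℕ} (d : ℕ) (o : Fin n) (s : ℝ) (i : Fin n) (_ : Fin d)
    (b : Bool) : ℝ :=
  if i = o then -2 * s else s * bitSign b

section hardEntry

variable {n d : ℕ} {o : Fin n} {σ : Fin n × Fin d → Bool}

theorem bitMatrix_hardEntry_smul (ρ s : ℝ) :
    bitMatrix (hardEntry d o (ρ * s)) σ = fun i => ρ • bitMatrix (hardEntry d o s) σ i := by
  funext i
  ext j
  simp only [bitMatrix, hardEntry, PiLp.smul_apply, smul_eq_mul]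
  split_ifs <;> ring

theorem inner_bitMatrix (v : Fin n → Fin d → Bool → ℝ) (i j : Fin n) :
    ⟪bitMatrix v σ i, bitMatrix v σ j⟫ = ∑ c, v i c (σ (i, c)) * v j c (σ (j, c)) := by
  simp [PiLp.inner_apply, bitMatrix, mul_comm]

theorem inner_hardEntry {i j : Fin n} (hi : i ≠ o) (hj : j ≠ o) (hij : i ≠ j) (s : ℝ) :
    ⟪bitMatrix (hardEntry d o s) σ i, bitMatrix (hardEntry d o s) σ j⟫ =
      s ^ 2 * paritySum {i, j} σ := by
  rw [inner_bitMatrix, paritySum, Finset.mul_sum]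
  refine Finset.sum_congr rfl fun c _ => ?_
  rw [Finset.prod_pair hij, hardEntry, hardEntry, if_neg hi, if_neg hj]
  ring

theorem norm_hardEntry {i : Fin n} (hd : 0 < d) (hi : i ≠ o) :
    ‖bitMatrix (hardEntry d o (1 / √d)) σ i‖ = 1 := by
  have hd' : (0 : ℝ) < d := by exact_mod_cast hd
  rw [norm_eq_sqrt_real_inner, inner_bitMatrix, Real.sqrt_eq_one]
  have h : ∀ c, hardEntry d o (1 / √d) i c (σ (i, c)) * hardEntry d o (1 / √d) i c (σ (i, c)) =
      1 / d := by
    intro c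
    rw [hardEntry, if_neg hi, mul_mul_mul_comm, bitSign_mul_self, mul_one, div_mul_div_comm,
      Real.mul_self_sqrt hd'.le, one_mul]
  rw [Finset.sum_congr rfl fun c _ => h c]
  simp [hd'.ne']

theorem norm_const_vector (hd : 0 < d) :
    ‖(WithLp.toLp 2 fun _ => 1 / √d : EuclideanSpace ℝ (Fin d))‖ = 1 := by
  have hd' : (0 : ℝ) < d := by exact_mod_cast hd
  rw [EuclideanSpace.norm_eq, Real.sqrt_eq_one]
  simp [hd'.ne', hd'.le]

theorem hardEntry_self (s : ℝ) : bitMatrix (hardEntry d o s) σ o =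
    (-2 : ℝ) • (WithLp.toLp 2 fun _ => s : EuclideanSpace ℝ (Fin d)) := by
  ext j
  simp [bitMatrix, hardEntry]

theorem inner_const_hardEntry {i : Fin n} (hi : i ≠ o) (s : ℝ) :
    ⟪(WithLp.toLp 2 fun _ => s : EuclideanSpace ℝ (Fin d)), bitMatrix (hardEntry d o s) σ i⟫ =
      s ^ 2 * paritySum {i} σ := by
  simp only [PiLp.inner_apply, bitMatrix, hardEntry, if_neg hi, paritySum, Finset.mul_sum,
    Finset.prod_singleton]
  refine Finset.sum_congr rfl fun c _ => ?_
  simp only [RCLike.inner_apply, conj_trivial]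
  ring

/-- The row biases, with opposite bias in row `p`. -/
noncomputable def plantedBias (μ : ℝ) (p i : Fin n) : ℝ := if i = p then μ else -μ

/-- If no inner product deviates much from its mean, every coreset contains the planted row. -/
theorem IsMEBCoreset.planted_mem {ε k ρ μ t : ℝ} {S : Finset (Fin n)} {p : Fin n}
    (hd : 0 < d) (hρ : 0 < ρ)
    (h : IsMEBCoreset ε k (bitMatrix (hardEntry d o (ρ * (1 / √d))) σ) S)
    (hε : 0 < ε) (hμ : μ = 32 * ε) (ht : t = μ / 16) (hμ1 : μ ≤ 1 / 16) (hop : o ≠ p)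
    (hgood : ∀ i j : Fin n, |paritySum {i, j} σ - d * ∏ r ∈ {i, j}, plantedBias μ p r| ≤ t * d) :
    p ∈ S := by
  have hd' : (0 : ℝ) < d := by exact_mod_cast hd
  have hs : (1 / √(d : ℝ)) ^ 2 = 1 / d := by rw [div_pow, Real.sq_sqrt hd'.le, one_pow]
  have hdev : ∀ i j m, ∏ r ∈ {i, j}, plantedBias μ p r = m →
      |(1 / √(d : ℝ)) ^ 2 * paritySum {i, j} σ - m| ≤ t := by
    intro i j m hm
    have := hgood i j
    rw [hm] at this
    rw [hs, show 1 / (d : ℝ) * paritySum {i, j} σ - m = (paritySum {i, j} σ - d * m) / d by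
      field_simp, abs_div, abs_of_pos hd', div_le_iff₀ hd']
    exact this
  have h' : IsMEBCoreset ε k (bitMatrix (hardEntry d o (1 / √d)) σ) S := by
    have := h.smul (inv_pos.2 hρ)
    rwa [bitMatrix_hardEntry_smul, funext fun i => inv_smul_smul₀ hρ.ne' _] at this
  refine h'.mem_of_nearly_orthogonal hε hμ ht hμ1 hop (norm_const_vector hd)
    (hardEntry_self _) (fun i hi => norm_hardEntry hd hi) ?_ ?_ ?_ ?_
  -- Writing {i} as {i, i} lets one bound over pairs also cover the inner products with u.
  · intro i hi hip
    rw [inner_const_hardEntry hi, ← sub_neg_eq_add, ← Finset.pair_eq_singleton i]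
    exact hdev _ _ _ (by rw [Finset.pair_eq_singleton, Finset.prod_singleton, plantedBias,
      if_neg hip])
  · rw [inner_const_hardEntry hop.symm, ← Finset.pair_eq_singleton p]
    exact hdev _ _ _ (by rw [Finset.pair_eq_singleton, Finset.prod_singleton, plantedBias,
      if_pos rfl])
  · intro i j hi hj hip hjp hij
    rw [inner_hardEntry hi hj hij]
    refine hdev _ _ _ ?_
    rw [Finset.prod_pair hij, plantedBias, plantedBias, if_neg hip, if_neg hjp]
    ring
  · intro i hi hip
    rw [inner_hardEntry hop.symm hi (Ne.symm hip), ← sub_neg_eq_add]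
    refine hdev _ _ _ ?_
    rw [Finset.prod_pair (Ne.symm hip), plantedBias, plantedBias, if_pos rfl, if_neg hip]
    ring

end hardEntry

/-! ### Averaging over the planted row -/

section planted

variable {n d : ℕ} {μ : ℝ}

theorem abs_plantedBias_lt (h0 : 0 < μ) (h1 : μ ≤ 1 / 2) (p i : Fin n) :
    |plantedBias μ p i| < 1 := by
  rw [plantedBias]
  split_ifs <;> rw [abs_lt] <;> constructor <;> linarith

/-- A query algorithm with few reads does not find the planted row, on average. -/
theorem QueryTree.sum_planted_hit_le (T : QueryTree n d) (v : Fin n → Fin d → Bool → ℝ) {k q : ℝ}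
    (hk : 0 ≤ k) (hq : ∀ σ, ((T.positionsRead (bitMatrix v σ)).card : ℝ) ≤ q)
    (h0 : 0 < μ) (h1 : μ ≤ 1 / 2) :
    ∑ p, bitExpect (rowCoin d (plantedBias μ p)) (fun σ =>
      if p ∈ T.result (bitMatrix v σ) ∧ ((T.result (bitMatrix v σ)).card : ℝ) ≤ k then 1 else 0) ≤
      2 * (k + 4 * μ ^ 2 * q) := by
  -- The reference law `m₀` has no planted row; it differs from the law planted at `p` only in row
  -- `p`.
  set row : Fin n → Finset (Fin n × Fin d) := fun p => {x | x.1 = p} with hrow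
  set m₀ : Fin n → ℝ := fun _ => -μ with hm₀
  have hm₀' : ∀ i, |m₀ i| < 1 := fun i => by rw [hm₀, abs_neg, abs_of_pos h0]; linarith
  have hnn : ∀ x b, 0 ≤ rowCoin d m₀ x b := fun x b => (coin_pos (hm₀' x.1) b).le
  have hnn₁ : ∀ (p : Fin n) x b, 0 ≤ rowCoin d (plantedBias μ p) x b := fun p x b =>
    (coin_pos (abs_plantedBias_lt h0 h1 p x.1) b).le
  have hone : ∀ x, ∑ b, rowCoin d m₀ x b = 1 := fun x => sum_coin _
  have hp : ∀ p, bitExpect (rowCoin d (plantedBias μ p)) (fun σ =>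
      if p ∈ T.result (bitMatrix v σ) ∧ ((T.result (bitMatrix v σ)).card : ℝ) ≤ k then 1 else 0) ≤
      2 * (bitExpect (rowCoin d m₀) (fun σ =>
        if p ∈ T.result (bitMatrix v σ) ∧ ((T.result (bitMatrix v σ)).card : ℝ) ≤ k
          then 1 else 0) + 4 * μ ^ 2 * bitExpect (rowCoin d m₀) (fun σ =>
            ((T.positionsRead (bitMatrix v σ) ∩ row p).card : ℝ))) := by
    intro p
    have h := T.bitExpect_change_of_measure v (fun S => p ∈ S ∧ (S.card : ℝ) ≤ k) (4 * μ ^ 2)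
      (rowCoin d m₀) (rowCoin d (plantedBias μ p)) (row p) 0 hnn hone (fun x => sum_coin _)
      (fun x hx => by
        have hx : x.1 ≠ p := by simpa [hrow] using hx
        rw [rowCoin, rowCoin, plantedBias, if_neg hx])
      (fun x _ b => ⟨coin_pos (hm₀' x.1) b, coin_pos (abs_plantedBias_lt h0 h1 p x.1) b⟩)
      (fun x hx => by
        have hx : x.1 = p := by simpa [hrow] using hx
        simp only [rowCoin, plantedBias, if_pos hx]
        exact neg_le_sum_coin_log h0 h1)
    rw [Real.exp_zero, one_mul, zero_add] at h
    have he : Real.exp (-1) ≤ 1 / 2 := by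
      rw [Real.exp_neg, one_div]
      exact inv_anti₀ two_pos (by linarith [Real.add_one_le_exp (1 : ℝ)])
    have hY : 0 ≤ bitExpect (rowCoin d (plantedBias μ p)) (fun σ =>
        if p ∈ T.result (bitMatrix v σ) ∧ ((T.result (bitMatrix v σ)).card : ℝ) ≤ k
          then 1 else 0) :=
      bitExpect.nonneg (hnn₁ p) fun σ => by split_ifs <;> norm_num
    nlinarith [mul_nonneg (sub_nonneg.2 he) hY]
  refine (Finset.sum_le_sum fun p _ => hp p).trans ?_
  rw [← Finset.mul_sum, Finset.sum_add_distrib, ← Finset.mul_sum, ← bitExpect.sum,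
    ← bitExpect.sum]
  have hhit : ∀ σ, ∑ p, (if p ∈ T.result (bitMatrix v σ) ∧
      ((T.result (bitMatrix v σ)).card : ℝ) ≤ k then (1 : ℝ) else 0) ≤ k := by
    intro σ
    by_cases hc : ((T.result (bitMatrix v σ)).card : ℝ) ≤ k
    · simp [hc]
    · simp [hc, hk]
  have hread : ∀ σ, ∑ p, ((T.positionsRead (bitMatrix v σ) ∩ row p).card : ℝ) ≤ q := by
    intro σ
    refine le_trans (le_of_eq ?_) (hq σ)
    rw [Finset.card_eq_sum_card_fiberwise (f := Prod.fst) (t := Finset.univ)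
      (fun _ _ => Finset.mem_coe.2 (Finset.mem_univ _)), Nat.cast_sum]
    refine Finset.sum_congr rfl fun p _ => ?_
    congr 2
    ext x
    simp [hrow]
  have e1 := (bitExpect.mono hnn hhit).trans_eq (bitExpect.const hone k)
  have e2 := (bitExpect.mono hnn hread).trans_eq (bitExpect.const hone q)
  have := mul_le_mul_of_nonneg_left e2 (show 0 ≤ 4 * μ ^ 2 by positivity)
  linarith

/-- With high probability no inner product deviates much from its mean. -/
theorem bitExpect_deviation_le (h0 : 0 < μ) (h1 : μ ≤ 1 / 2) (p : Fin n) {t : ℝ} (ht0 : 0 ≤ t)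
    (ht1 : t ≤ 2) :
    bitExpect (rowCoin d (plantedBias μ p)) (fun σ =>
      if ∀ i j : Fin n, |paritySum {i, j} σ - d * ∏ r ∈ {i, j}, plantedBias μ p r| ≤ t * d
        then 0 else 1) ≤ n ^ 2 * (2 * Real.exp (-(d * t ^ 2 / 4))) := by
  have hm := abs_plantedBias_lt (n := n) h0 h1 p
  have h : ∀ σ : Fin n × Fin d → Bool,
      (if ∀ i j : Fin n, |paritySum {i, j} σ - d * ∏ r ∈ {i, j}, plantedBias μ p r| ≤ t * d
        then (0 : ℝ) else 1) ≤ ∑ x : Fin n × Fin n,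
        if t * d < |paritySum {x.1, x.2} σ - d * ∏ r ∈ {x.1, x.2}, plantedBias μ p r|
          then 1 else 0 := by
    intro σ
    have hnn : ∀ x ∈ (Finset.univ : Finset (Fin n × Fin n)), (0 : ℝ) ≤
        if t * d < |paritySum {x.1, x.2} σ - d * ∏ r ∈ {x.1, x.2}, plantedBias μ p r|
          then 1 else 0 := fun x _ => by split_ifs <;> norm_num
    split_ifs with hgood
    · exact Finset.sum_nonneg hnn
    · push Not at hgood
      obtain ⟨i, j, hij⟩ := hgood
      refine le_trans ?_ (Finset.single_le_sum hnn (Finset.mem_univ (i, j)))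
      rw [if_pos hij]
  refine le_trans (bitExpect.mono (p := rowCoin d (plantedBias μ p))
    (fun x b => (coin_pos (hm x.1) b).le) h) ?_
  rw [bitExpect.sum]
  refine (Finset.sum_le_card_nsmul _ _ _ fun x _ =>
    bitExpect.paritySum_tail_le hm {x.1, x.2} ht0 ht1).trans_eq ?_
  simp [sq]

end planted

/-! ### Lower bounds for small and large ε -/

namespace RandomizedAlgorithm

variable {Ω : Type*} [MeasurableSpace Ω] {n d : ℕ} {alg : RandomizedAlgorithm Ω n d}
  {P : Measure Ω} [IsProbabilityMeasure P] {ε k R q : ℝ}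

/-- The lower bound for small `ε`, up to the choice of constants. -/
theorem not_read_few_of_small (hsolve : alg.SolvesMEBCoreset P ε k R)
    (hread : ∀ A : Fin n → EuclideanSpace ℝ (Fin d), (∀ i, ‖A i‖ ≤ R) →
      P {ω | q ≤ alg.entriesRead A ω} = 0)
    (hε : 0 < ε) (hε1 : ε ≤ 1 / 512) (hR : 0 < R) (hn : 20 ≤ n) (hd : 0 < d) (hk0 : 0 ≤ k)
    (hk : 20 * k ≤ n) (hexp : n ^ 2 * (2 * Real.exp (-(d * ε ^ 2))) ≤ 1 / 10)
    (hq : 81920 * (ε ^ 2 * q) ≤ n) : False := by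
  classical
  have hn' : (20 : ℝ) ≤ n := by exact_mod_cast hn
  let o : Fin n := ⟨0, by omega⟩
  set μ := 32 * ε with hμ
  have hμ0 : 0 < μ := by positivity
  set v := hardEntry d o (R / 2 * (1 / √d)) with hv
  have hρ : 0 < R / 2 := half_pos hR
  -- The norms reveal neither the signs nor the planted row, so one decision tree serves all the
  -- inputs.
  have hnorm : ∀ σ i, ‖bitMatrix v σ i‖ = if i = o then R else R / 2 := by
    intro σ i
    rw [hv, bitMatrix_hardEntry_smul, norm_smul, Real.norm_of_nonneg hρ.le]
    split_ifs with hi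
    · rw [hi, hardEntry_self, norm_smul, norm_const_vector hd]
      norm_num
    · rw [norm_hardEntry hd hi, mul_one]
  have hnormR : ∀ σ i, ‖bitMatrix v σ i‖ ≤ R := fun σ i => by
    rw [hnorm]; split_ifs <;> linarith
  set w : Fin n → (Fin n × Fin d → Bool) → ℝ :=
    fun p σ => ∏ x, rowCoin d (plantedBias μ p) x (σ x) with hw
  have hcoin : ∀ (p : Fin n) x b, 0 ≤ rowCoin d (plantedBias μ p) x b := fun p x b =>
    (coin_pos (abs_plantedBias_lt hμ0 (by linarith) p x.1) b).le
  obtain ⟨ω, hωq, hω⟩ := exists_coins hsolve hread (fun σ => ∑ p ∈ Finset.univ.erase o, w p σ)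
    (fun σ => Finset.sum_nonneg fun p _ => Finset.prod_nonneg fun x _ => hcoin p x _)
    (fun σ => bitMatrix v σ) hnormR
  set T := alg.tree ω fun i => if i = o then R else R / 2 with hT
  have hres : ∀ σ, alg.result (bitMatrix v σ) ω = T.result (bitMatrix v σ) := fun σ => by
    rw [RandomizedAlgorithm.result, funext fun i => hnorm σ i]
  have hpos : ∀ σ, ((T.positionsRead (bitMatrix v σ)).card : ℝ) ≤ q := fun σ => by
    have := (hωq σ).le
    rwa [RandomizedAlgorithm.entriesRead, funext fun i => hnorm σ i] at this
  have hone : ∀ p, ∑ σ, w p σ = 1 := fun p => by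
    rw [hw, bitExpect.sum_prod]
    exact Finset.prod_eq_one fun x _ => sum_coin _
  rw [Finset.sum_comm, Finset.sum_congr rfl fun p _ => hone p, Finset.sum_const,
    Finset.card_erase_of_mem (Finset.mem_univ o), Finset.card_univ, Fintype.card_fin,
    nsmul_eq_mul, mul_one, Nat.cast_sub (by omega), Nat.cast_one] at hω
  simp only [Finset.sum_mul, hres] at hω
  rw [Finset.sum_comm] at hω
  have hsucc : ∀ p ∈ Finset.univ.erase o, (∑ σ, w p σ *
      if IsMEBCoreset ε k (bitMatrix v σ) (T.result (bitMatrix v σ)) then 1 else 0) ≤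
      bitExpect (rowCoin d (plantedBias μ p)) (fun σ => if p ∈ T.result (bitMatrix v σ) ∧
        ((T.result (bitMatrix v σ)).card : ℝ) ≤ k then 1 else 0) + 1 / 10 := by
    intro p hp
    have hdev := (bitExpect_deviation_le (d := d) hμ0 (by linarith) p
      (t := μ / 16) (by positivity) (by linarith))
    rw [show (d : ℝ) * (μ / 16) ^ 2 / 4 = d * ε ^ 2 by rw [hμ]; ring] at hdev
    refine le_trans ?_ (add_le_add_right (hdev.trans hexp) _)
    rw [← bitExpect.add]
    refine bitExpect.mono (hcoin p) fun σ => ?_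
    by_cases hgood : ∀ i j : Fin n,
        |paritySum {i, j} σ - d * ∏ r ∈ {i, j}, plantedBias μ p r| ≤ μ / 16 * d
    · rw [if_pos hgood, add_zero]
      by_cases hc : IsMEBCoreset ε k (bitMatrix v σ) (T.result (bitMatrix v σ))
      · rw [if_pos hc, if_pos ⟨hc.planted_mem hd hρ hε hμ rfl (by linarith)
          (Finset.ne_of_mem_erase hp).symm hgood, hc.2.1⟩]
      · rw [if_neg hc]
        split_ifs <;> norm_num
    · rw [if_neg hgood]
      split_ifs <;> norm_num
  have hsum := hω.trans (Finset.sum_le_sum hsucc)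
  rw [Finset.sum_add_distrib, Finset.sum_const, Finset.card_erase_of_mem (Finset.mem_univ o),
    Finset.card_univ, Fintype.card_fin, nsmul_eq_mul, Nat.cast_sub (by omega), Nat.cast_one]
    at hsum
  have hhit := T.sum_planted_hit_le v hk0 hpos hμ0 (by linarith)
  have hsub : ∑ p ∈ Finset.univ.erase o, bitExpect (rowCoin d (plantedBias μ p)) (fun σ =>
      if p ∈ T.result (bitMatrix v σ) ∧ ((T.result (bitMatrix v σ)).card : ℝ) ≤ k
        then 1 else 0) ≤ 2 * (k + 4 * μ ^ 2 * q) := by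
    refine le_trans (Finset.sum_le_sum_of_subset_of_nonneg (Finset.erase_subset _ _)
      fun p _ _ => ?_) hhit
    exact bitExpect.nonneg (hcoin p) fun σ => by split_ifs <;> norm_num
  -- Now (4/5)(n - 1) ≤ 2k + 8192ε²q + (n - 1)/10 ≤ n/5 + (n - 1)/10, which fails for n ≥ 20.
  have : 4 * μ ^ 2 * q = 4096 * (ε ^ 2 * q) := by rw [hμ]; ring
  linarith

/-- A row opposite to all the others is in every coreset. -/
theorem _root_.IsMEBCoreset.mem_of_opposite {A : Fin n → EuclideanSpace ℝ (Fin d)}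
    {S : Finset (Fin n)} (h : IsMEBCoreset ε k A S) {p : Fin n} {w : EuclideanSpace ℝ (Fin d)}
    (hε : 0 < ε) (hw : w ≠ 0) (hA : A = fun i => if i = p then w else -w) : p ∈ S := by
  by_contra hp
  obtain ⟨⟨i, hi⟩, -, x, r, hx, hball⟩ := h
  have hS : ∀ j ∈ S, A j = -w := fun j hj => by
    rw [hA]; exact if_neg fun h : j = p => hp (h ▸ hj)
  have hr : r ≤ 0 := hx.2 (-w) 0 <| by
    rintro _ ⟨j, hj, rfl⟩
    rw [hS j hj]
    exact Metric.mem_closedBall_self le_rfl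
  have h1 := hx.norm_sub_le (Set.mem_image_of_mem A hi)
  have h2 := hball p
  rw [Metric.mem_closedBall, dist_eq_norm] at h2
  have e1 := norm_le_zero_iff.1 (h1.trans hr)
  have e2 := norm_le_zero_iff.1
    (h2.trans (mul_nonpos_of_nonneg_of_nonpos (by linarith) hr))
  rw [hS i hi, sub_eq_zero] at e1
  have hAp : A p = w := by rw [hA]; exact if_pos rfl
  rw [← e1, hAp, sub_neg_eq_add, ← two_smul ℝ, smul_eq_zero] at e2
  exact hw (e2.resolve_left two_ne_zero)

/-- The lower bound for large `ε`, up to the choice of constants. -/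
theorem not_read_few_of_large (hsolve : alg.SolvesMEBCoreset P ε k R)
    (hread : ∀ A : Fin n → EuclideanSpace ℝ (Fin d), (∀ i, ‖A i‖ ≤ R) →
      P {ω | q ≤ alg.entriesRead A ω} = 0)
    (hε : 0 < ε) (hR : 0 < R) (hn : 0 < n) (hd : 0 < d) (hk0 : 0 ≤ k)
    (hk : 20 * k ≤ n) (hq : 4 * q ≤ n) : False := by
  classical
  have hn' : (0 : ℝ) < n := by exact_mod_cast hn
  set w : EuclideanSpace ℝ (Fin d) := EuclideanSpace.single ⟨0, hd⟩ R with hw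
  have hwR : ‖w‖ = R := by simp [hw, abs_of_pos hR]
  have hw0 : w ≠ 0 := norm_ne_zero_iff.1 (hwR ▸ hR.ne')
  set A : Option (Fin n) → Fin n → EuclideanSpace ℝ (Fin d) :=
    fun a i => if some i = a then w else -w with hA
  have hnorm : ∀ a i, ‖A a i‖ = R := by
    intro a i
    simp only [hA]
    split_ifs
    · exact hwR
    · rw [norm_neg, hwR]
  -- The matrix `none` without a planted row has weight 0 but belongs to the family, so that the
  -- chosen coins also read few of its entries.
  obtain ⟨ω, hωq, hω⟩ := exists_coins hsolve hread (fun a => if a.isSome then 1 else 0)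
    (fun a => by split_ifs <;> norm_num) A fun a i => (hnorm a i).le
  set T := alg.tree ω fun _ => R with hT
  have hres : ∀ a, alg.result (A a) ω = T.result (A a) := fun a => by
    rw [RandomizedAlgorithm.result, funext fun i => hnorm a i]
  have hpos := (hωq none).le
  rw [RandomizedAlgorithm.entriesRead, funext fun i => hnorm none i, ← hT] at hpos
  simp only [Fintype.sum_option, Option.isSome_none, Option.isSome_some, if_true, zero_add,
    Bool.false_eq_true, if_false, zero_mul, one_mul, Finset.sum_const, Finset.card_univ,
    Fintype.card_fin, nsmul_eq_mul, mul_one, hres] at hω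
  set S := T.result (A none) with hS
  set rows := (T.positionsRead (A none)).image Prod.fst with hrows
  have hle : ∀ p : Fin n, (if IsMEBCoreset ε k (A (some p)) (T.result (A (some p)))
      then (1 : ℝ) else 0) ≤
      (if p ∈ rows then 1 else 0) + if p ∈ S ∧ (S.card : ℝ) ≤ k then 1 else 0 := by
    intro p
    by_cases hp : p ∈ rows
    · rw [if_pos hp]
      split_ifs <;> norm_num
    · have hTS : T.result (A (some p)) = S := T.result_congr fun x hx => by
        have hxp : x.1 ≠ p := fun h => hp (Finset.mem_image.2 ⟨x, hx, h⟩)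
        simp [hA, hxp]
      rw [if_neg hp, zero_add, hTS]
      by_cases hc : IsMEBCoreset ε k (A (some p)) S
      · rw [if_pos hc, if_pos ⟨hc.mem_of_opposite hε hw0 (by simp [hA]), hc.2.1⟩]
      · rw [if_neg hc]
        split_ifs <;> norm_num
  -- A planted row is found only if the run on `none` reads it or outputs it, so 4n/5 ≤ q + k,
  -- whereas q ≤ n/4 and k ≤ n/20.
  have hsum := hω.trans (Finset.sum_le_sum fun p _ => hle p)
  rw [Finset.sum_add_distrib] at hsum
  have e1 : ∑ p, (if p ∈ rows then (1 : ℝ) else 0) ≤ q := by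
    have : (rows.card : ℝ) ≤ q := le_trans (by exact_mod_cast Finset.card_image_le) hpos
    simpa using this
  have e2 : ∑ p, (if p ∈ S ∧ (S.card : ℝ) ≤ k then (1 : ℝ) else 0) ≤ k := by
    by_cases hc : (S.card : ℝ) ≤ k
    · simp [hc]
    · simp [hc, hk0]
  linarith

end RandomizedAlgorithm

/-! ### Choice of constants -/

theorem mainTheorem10 (C : ℝ) (hC : 0 < C) (c : ℕ) :
    ∃ (K : ℝ) (k : ℕ) (c₀ : ℝ) (m : ℕ), 0 < K ∧ 0 < c₀ ∧
      ∀ (n d : ℕ) (ε R : ℝ), 0 < ε → ε < 1 → 0 < R →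
        (d : ℝ) ≤ n * ε⁻¹ →
        K * ε⁻¹ ^ 2 * logFactor n d ε ^ k ≤ d →
        ∀ (Ω : Type*) [MeasurableSpace Ω] (P : Measure Ω) [IsProbabilityMeasure P]
          (alg : RandomizedAlgorithm Ω n d),
          alg.SolvesMEBCoreset P ε (C * ε⁻¹ * logFactor n d ε ^ c) R →
          ∃ A : Fin n → EuclideanSpace ℝ (Fin d), (∀ i, ‖A i‖ ≤ R) ∧
            0 < P {ω | c₀ * n * ε⁻¹ ^ 2 / logFactor n d ε ^ m ≤ alg.entriesRead A ω} := by
  -- Since n ≥ dε, the term 20C makes the coreset size at most n/20. The term 100 gives n ≥ 20 and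
  -- pays for the union bound over n² pairs, which needs one factor L even for c = 0. The constant
  -- 2⁻²⁰ makes q ≤ n/4 when ε⁻¹ ≤ 512, as 512² = 2¹⁸.
  refine ⟨20 * C + 100, c + 1, 1 / 2 ^ 20, 0, by positivity, by positivity, ?_⟩
  intro n d ε R hε hε1 hR hdn hKd Ω _ P _ alg hsolve
  by_contra! hcon
  have hread : ∀ A : Fin n → EuclideanSpace ℝ (Fin d), (∀ i, ‖A i‖ ≤ R) →
      P {ω | 1 / 2 ^ 20 * n * ε⁻¹ ^ 2 / logFactor n d ε ^ 0 ≤ alg.entriesRead A ω} = 0 :=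
    fun A hA => nonpos_iff_eq_zero.1 (hcon A hA)
  rw [pow_zero, div_one] at hread
  have hεinv : 1 ≤ ε⁻¹ := (one_le_inv₀ hε).2 hε1.le
  -- For n = 0 or d = 0 the convention log 0 = 0 gives L = 1, and the hypotheses contradict each
  -- other.
  have hn : 0 < n := by
    rcases Nat.eq_zero_or_pos n with rfl | hn
    · have hL : logFactor 0 d ε = 1 := by simp [logFactor]
      rw [hL, one_pow, mul_one] at hKd
      rw [Nat.cast_zero, zero_mul] at hdn
      have : 0 < (20 * C + 100) * ε⁻¹ ^ 2 := by positivity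
      linarith
    · exact hn
  have hn' : (1 : ℝ) ≤ n := by exact_mod_cast hn
  have hd : 0 < d := by
    rcases Nat.eq_zero_or_pos d with rfl | hd
    · have hL : logFactor n 0 ε = 1 := by simp [logFactor]
      rw [hL, one_pow, mul_one, Nat.cast_zero] at hKd
      have : 0 < (20 * C + 100) * ε⁻¹ ^ 2 := by positivity
      linarith
    · exact hd
  have hd' : (1 : ℝ) ≤ d := by exact_mod_cast hd
  set L := logFactor n d ε with hL
  have hLn : 1 + Real.log n ≤ L := by
    rw [hL, logFactor]
    refine add_le_add_right (Real.log_le_log (by linarith) ?_) 1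
    rw [le_div_iff₀ hε]
    exact mul_le_mul_of_nonneg_left (hε1.le.trans hd') (by linarith)
  have hL1 : 1 ≤ L := by linarith [Real.log_nonneg hn']
  have hLc : 1 ≤ L ^ c := one_le_pow₀ hL1
  have hdε : (20 * C + 100) * L ^ (c + 1) ≤ d * ε ^ 2 := by
    have := mul_le_mul_of_nonneg_right hKd (sq_nonneg ε)
    rwa [show (20 * C + 100) * ε⁻¹ ^ 2 * L ^ (c + 1) * ε ^ 2 =
      (20 * C + 100) * L ^ (c + 1) by field_simp] at this
  have hnε : (20 * C + 100) * ε⁻¹ * L ^ c ≤ n := by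
    have h1 : d * ε ^ 2 ≤ n * ε := by
      have := mul_le_mul_of_nonneg_right hdn (sq_nonneg ε)
      rwa [show n * ε⁻¹ * ε ^ 2 = n * ε by field_simp] at this
    have h2 : (20 * C + 100) * L ^ c ≤ (20 * C + 100) * L ^ (c + 1) :=
      mul_le_mul_of_nonneg_left (pow_le_pow_right₀ hL1 c.le_succ) (by positivity)
    rw [mul_right_comm, ← div_eq_mul_inv, div_le_iff₀ hε]
    linarith
  have hprod : 1 ≤ ε⁻¹ * L ^ c := one_le_mul_of_one_le_of_one_le hεinv hLc
  have hCp : 0 ≤ C * (ε⁻¹ * L ^ c) := by positivity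
  have hk : 20 * (C * ε⁻¹ * L ^ c) ≤ n := by linarith
  have hk0 : 0 ≤ C * ε⁻¹ * L ^ c := by linarith
  have hn20 : (20 : ℝ) ≤ n := by linarith
  rcases le_or_gt ε (1 / 512) with hsmall | hlarge
  · refine RandomizedAlgorithm.not_read_few_of_small hsolve hread hε hsmall hR
      (by exact_mod_cast hn20) hd hk0 hk ?_ ?_
    · have h1 : 19 + 2 * Real.log n ≤ d * ε ^ 2 := by
        have hLL : L ≤ L ^ (c + 1) := le_self_pow₀ hL1 (by omega)
        have h100 : 100 * L ^ (c + 1) ≤ (20 * C + 100) * L ^ (c + 1) :=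
          mul_le_mul_of_nonneg_right (by linarith) (by positivity)
        linarith [Real.log_nonneg hn']
      have h2 : Real.exp (-(d * ε ^ 2)) ≤ Real.exp (-19) * ((n : ℝ) ^ 2)⁻¹ := by
        have hexp : (n : ℝ) ^ 2 = Real.exp (2 * Real.log n) := by
          rw [two_mul, Real.exp_add, Real.exp_log (by linarith), sq]
        rw [hexp, ← Real.exp_neg, ← Real.exp_add]
        exact Real.exp_le_exp.2 (by linarith)
      have h3 : Real.exp (-19) ≤ 1 / 20 := by
        rw [Real.exp_neg, one_div]
        exact inv_anti₀ (by norm_num) (by linarith [Real.add_one_le_exp (19 : ℝ)])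
      calc (n : ℝ) ^ 2 * (2 * Real.exp (-(d * ε ^ 2)))
          ≤ (n : ℝ) ^ 2 * (2 * (Real.exp (-19) * ((n : ℝ) ^ 2)⁻¹)) := by gcongr
        _ = 2 * Real.exp (-19) := by
            have : (n : ℝ) ≠ 0 := by linarith
            field_simp
        _ ≤ 1 / 10 := by linarith
    · rw [show ε ^ 2 * (1 / 2 ^ 20 * n * ε⁻¹ ^ 2) = 1 / 2 ^ 20 * (n : ℝ) by field_simp]
      linarith
  · refine RandomizedAlgorithm.not_read_few_of_large hsolve hread hε hR hn hd hk0 hk ?_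
    have h1 : ε⁻¹ ≤ 512 := by
      rw [inv_le_comm₀ hε (by norm_num)]
      linarith
    have h2 : ε⁻¹ ^ 2 ≤ 512 ^ 2 := pow_le_pow_left₀ (by positivity) h1 2
    have := mul_le_mul_of_nonneg_left h2 (show 0 ≤ 1 / 2 ^ 20 * (n : ℝ) by positivity)
    linarith
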